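/- **Model.** In the contention game with $n$ players and $k$ channels, time is slotted ($t=1,2,\dots$) and all $n$ players are pending initially. In each slot every pending player chooses an action in $\{0,1,\dots,k\}$: $0$ means no transmission, $a\ge 1$ means transmission on channel $a$. If exactly one player transmits on a channel, she is successful and leaves the game; if several players transmit on the same channel, they all fail and remain pending. A protocol with acknowledgement-based feedback assigns to every $t\ge 1$ and every personal history $(X_{i,1},\dots,X_{i,t-1})$ of a pending player $i$ a probability distribution on $\{0,\dots,k\}$, from which her action $X_{i,t}$ in slot $t$ is drawn, independently of the other players' draws in that slot. The latency $T_i\in\{1,2,\dots\}\cup\{\infty\}$ of player $i$ is the slot in which she transmits successfully. A profile $(f_1,\dots,f_n)$ of protocols is an equilibrium if for every player $i$, every $t\ge 0$ and every transmission history up to slot $t$ after which $i$ is pending, the conditional expectation of $T_i$ given this history cannot be decreased by replacing $f_i$ from slot $t+1$ on by another protocol $g$, the other players' protocols being fixed. This notion has two versions. In the first, one conditions on the personal history of $i$ and on $i$ being pending (player $i$ having played that personal history, the other players following their protocols, and this event having positive probability). In the second, one conditions on the history of all players, where every history that is possible under the rules of the game is considered. Let $f^3$ be the protocol for $k=3$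 channels that, in every slot and after every personal history, transmits on each of the three channels with probability $1/3$. **Theorem.** For $k=3$ channels and each $n\in\{2,3,4,5\}$, the profile in which all $n$ players use $f^3$ is an equilibrium, in both versions of the notion. The expected latency $\mathbb{E}[T_i]$ of each player $i$ under this profile is $3/2$, $15/8$, $189/80$ and $597/200$ for $n=2,3,4,5$, respectively. -/

import Mathlib

open MeasureTheory ProbabilityTheory
open scoped ENNReal

namespace Contention

/-- Actions of a player: `0` is no transmission, and `1, …, k` are the channels. -/
abbrev Action (k : ℕ) : Type := Fin (k + 1)

/-- Transmission vectors: the actions of all `n` players in one slot. -/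
abbrev TransVec (n k : ℕ) : Type := Fin n → Action k

/-- Transmission histories of all players over the slots `1, …, t`;
slot `s + 1` is the coordinate `s : Fin t`. -/
abbrev History (n k t : ℕ) : Type := Fin t → TransVec n k

/-- Personal transmission histories of one player over the slots `1, …, t`. -/
abbrev PersonalHistory (k t : ℕ) : Type := Fin t → Action k

/-- Acknowledgement-based protocols: `f t` is the decision rule for slot `t + 1`. It maps the
personal history of a pending player over the slots `1, …, t` to a mixed strategy. -/
abbrev Protocol (k : ℕ) : Type := (t : ℕ) → PersonalHistory k t → PMF (Action k)

/-- Player `i` transmits successfully in a slot with transmission vector `x`: she is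
the only one who transmits on her channel. -/
def Succeeds {n k : ℕ} (x : TransVec n k) (i : Fin n) : Prop :=
  x i ≠ 0 ∧ ∀ j, j ≠ i → x j ≠ x i

/-- The personal history of player `i` contained in the history `h` of all players. -/
def personal {n k t : ℕ} (h : History n k t) (i : Fin n) : PersonalHistory k t :=
  fun s => h s i

/-- Player `i` is still pending after the history `h`. -/
def Pending {n k t : ℕ} (h : History n k t) (i : Fin n) : Prop :=
  ∀ s, ¬ Succeeds (h s) i

/-- Histories that can arise in the game: a player who has been successful has left,
so she makes no further attempt. -/
def Feasible {n k t : ℕ} (h : History n k t) : Prop :=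
  ∀ (j : Fin n) (r s : Fin t), r < s → Succeeds (h r) j → h s j = 0

open Classical in
/-- Law of the transmission vector in slot `t + 1` given the history `h` of the slots `1, …, t`:
independently of each other, every pending player draws her action from her decision rule;
the other players do nothing. -/
noncomputable def stepLaw {n k : ℕ} (f : Fin n → Protocol k) {t : ℕ} (h : History n k t) :
    Measure (TransVec n k) :=
  Measure.pi fun j =>
    (if Pending h j then f j t (personal h j) else PMF.pure 0).toMeasure

instance {n k : ℕ} (f : Fin n → Protocol k) {t : ℕ} (h : History n k t) :
    IsProbabilityMeasure (stepLaw f h) := by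
  unfold stepLaw; infer_instance

/-- Sequences indexed by `0, …, t` carry a dummy entry at index `0`; this forgets it. -/
def ofSeq {n k t : ℕ} (x : Finset.Iic t → TransVec n k) : History n k t :=
  fun s => x ⟨(s : ℕ) + 1, Finset.mem_Iic.2 s.isLt⟩

/-- This puts the zero vector as a dummy entry at index `0`. -/
def toSeq {n k t : ℕ} (h : History n k t) : Finset.Iic t → TransVec n k :=
  fun s => if hs : (s : ℕ) = 0 then 0 else
    h ⟨(s : ℕ) - 1, by have := Finset.mem_Iic.1 s.2; omega⟩

theorem ofSeq_toSeq {n k t : ℕ} (h : History n k t) : ofSeq (toSeq h) = h := by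
  funext s
  simp [ofSeq, toSeq]

/-- The transition kernels of the game under the protocol profile `f`. -/
noncomputable def stepKernel {n k : ℕ} (f : Fin n → Protocol k) (t : ℕ) :
    Kernel (Finset.Iic t → TransVec n k) (TransVec n k) where
  toFun x := stepLaw f (ofSeq x)
  measurable' := Measurable.of_discrete

instance {n k : ℕ} (f : Fin n → Protocol k) (t : ℕ) : IsMarkovKernel (stepKernel f t) :=
  ⟨fun x => inferInstanceAs (IsProbabilityMeasure (stepLaw f (ofSeq x)))⟩

/-- Law of the transmission sequence `X 1, X 2, …` (with a dummy `X 0`) when its first `t` entries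
are given by the history `h` and the players follow the profile `f` from slot `t + 1` on. -/
noncomputable def gameLaw {n k : ℕ} (f : Fin n → Protocol k) {t : ℕ} (h : History n k t) :
    Measure (ℕ → TransVec n k) :=
  Kernel.traj (X := fun _ => TransVec n k) (stepKernel f) t (toSeq h)

/-- The empty history. -/
def emptyHistory (n k : ℕ) : History n k 0 := Fin.elim0

/-- The latency of player `i`: the first slot `t ≥ 1` in which she transmits successfully
(`∞` if there is none). -/
noncomputable def latency {n k : ℕ} (i : Fin n) (x : ℕ → TransVec n k) : ℝ≥0∞ :=
  ⨅ (t : ℕ) (_ : 1 ≤ t ∧ Succeeds (x t) i), (t : ℝ≥0∞)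

/-- Expected latency of player `i` given the history `h` of all players,
when the profile `f` is followed from slot `t + 1` on. -/
noncomputable def expLatency {n k : ℕ} (f : Fin n → Protocol k) (i : Fin n) {t : ℕ}
    (h : History n k t) : ℝ≥0∞ :=
  ∫⁻ x, latency i x ∂(gameLaw f h)

/-- The protocol that plays the actions `a` in the slots `1, …, t` and follows `g` afterwards. -/
noncomputable def playThen {k t : ℕ} (a : PersonalHistory k t) (g : Protocol k) : Protocol k :=
  fun s b => if hs : s < t then PMF.pure (a ⟨s, hs⟩) else g s b

/-- The event that player `i` has the personal history `a` and is pending after it. -/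
def personalEvent {n k t : ℕ} (i : Fin n) (a : PersonalHistory k t) : Set (ℕ → TransVec n k) :=
  {x | (∀ s : Fin t, x ((s : ℕ) + 1) i = a s) ∧ (t : ℝ≥0∞) < latency i x}

/-- The law of the game from its start when player `i` plays the actions `a` in the slots
`1, …, t` and follows `f i` afterwards, the other players following `f` throughout. -/
noncomputable def personalLaw {n k : ℕ} (f : Fin n → Protocol k) (i : Fin n) {t : ℕ}
    (a : PersonalHistory k t) : Measure (ℕ → TransVec n k) :=
  gameLaw (Function.update f i (playThen a (f i))) (emptyHistory n k)

/-- Expected latency of player `i` given that she is pending with personal history `a`, when she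
follows `f i` from slot `t + 1` on and the other players follow `f` throughout. -/
noncomputable def personalExpLatency {n k : ℕ} (f : Fin n → Protocol k) (i : Fin n) {t : ℕ}
    (a : PersonalHistory k t) : ℝ≥0∞ :=
  ∫⁻ x, latency i x ∂(cond (personalLaw f i a) (personalEvent i a))

/-- `f i` is a best response to the other protocols of the profile `f`, where expected latencies are
conditioned on the personal history of player `i` (the information that she has): after no personal
history with which she can be pending can she gain by deviating. -/
def IsBestResponse {n k : ℕ} (f : Fin n → Protocol k) (i : Fin n) : Prop :=
  ∀ (t : ℕ) (a : PersonalHistory k t), personalLaw f i a (personalEvent i a) ≠ 0 →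
    ∀ g : Protocol k, personalExpLatency f i a ≤ personalExpLatency (Function.update f i g) i a

/-- The same, where expected latencies are conditioned on the history of all players. -/
def IsFullBestResponse {n k : ℕ} (f : Fin n → Protocol k) (i : Fin n) : Prop :=
  ∀ (t : ℕ) (h : History n k t), Feasible h → Pending h i →
    ∀ g : Protocol k, expLatency f i h ≤ expLatency (Function.update f i g) i h

/-- Equilibrium, with expected latencies conditioned on personal histories. -/
def IsEquilibrium {n k : ℕ} (f : Fin n → Protocol k) : Prop :=
  ∀ i, IsBestResponse f i

/-- Equilibrium, with expected latencies conditioned on histories of all players. -/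
def IsFullEquilibrium {n k : ℕ} (f : Fin n → Protocol k) : Prop :=
  ∀ i, IsFullBestResponse f i

theorem sum_uniform (k : ℕ) [NeZero k] :
    ∑ a : Action k, (if a = 0 then 0 else (k : ℝ≥0∞)⁻¹) = 1 := by
  rw [Fin.sum_univ_succ]
  simp [Fin.succ_ne_zero, ENNReal.mul_inv_cancel, NeZero.ne k]

/-- The protocol `f ^ k`: in every slot and after every history, transmit with
probability `1 / k` on each of the `k` channels (and never stay silent). -/
noncomputable def uniformProtocol (k : ℕ) [NeZero k] : Protocol k :=
  fun _ _ => PMF.ofFintype (fun a => if a = 0 then 0 else (k : ℝ≥0∞)⁻¹) (sum_uniform k)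

/-- All `n` players use `f ^ k`. -/
noncomputable def uniformProfile (n k : ℕ) [NeZero k] : Fin n → Protocol k :=
  fun _ => uniformProtocol k

end Contention

/-!
Suppose that `m ≤ 5` players are pending and that all opponents of player `i` transmit uniformly on
the three channels. Let `E m` (`meanLatency m`) be the expected number of further slots that `i`
needs if she transmits uniformly as well. By symmetry of the channels, `E` solves a first-step
equation in which `i` may use any fixed channel, and a finite count over the actions of the
opponents (`scaledLatency_eq`, `scaledLatency_le`) shows that, for `m ≤ 5`, remaining silent in one
slot and continuing uniformly afterwards is no better.

The rest is a verification argument. Let `potential i t` be `t + E m` on the event that `i` is among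
`m` pending players after slot `t`, and her latency otherwise. Whatever `i` does, the potential is a
submartingale (`setLIntegral_potential_le_succ`), and it is a martingale while she transmits
uniformly (`setLIntegral_potential_succ_eq`). Since `E` is bounded, the potential after slot `N`
exceeds the latency by at most a constant on the event that the latency is at least `N`, and it
dominates the latency truncated at `N`. Letting `N` tend to infinity, the expected latency is
at least the expected potential after slot `t`, with equality if `i` transmits uniformly from slot
`t + 1` on (`setLIntegral_potential_le_latency`, `setLIntegral_latency_le_potential`). All this
holds on every event that is determined by the first `t` slots. The law of these slots does not
depend on what `i` does later, so that no deviation helps (`setLIntegral_latency_le`). The events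
`{h}` and `personalEvent i a` give the two notions of equilibrium, and the potential at the start
is the expected latency of the uniform profile.
-/

/-! ### The one-slot count -/

namespace Contention

/-- `400` (a common denominator) times the expected number of further slots that a pending
player needs when `m ≤ 5` players, herself included, are pending and all of them use
`uniformProtocol 3`. The values solve the first-step equations `scaledLatency_eq`; the argument `0`
does not occur, and beyond `5` the value is a dummy. -/
def scaledLatency : ℕ → ℕ
  | 1 => 400
  | 2 => 600
  | 3 => 750
  | 4 => 945
  | 5 => 1194
  | _ => 0

/-- The expected number of further slots of a pending player among `m` pending players. -/
noncomputable def meanLatency (m : ℕ) : ℝ≥0∞ := scaledLatency m / 400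

/-- The value of `scaledLatency` after a slot in which the player under consideration takes the
action `a` and the `d` other pending players transmit on the channels `y`; it is `0` if she
succeeds. The others that fail are those who meet her or one another. -/
def scaledCost {d : ℕ} (a : Action 3) (y : Fin d → Fin 3) : ℕ :=
  if a ≠ 0 ∧ ∀ l, (y l).succ ≠ a then 0
  else scaledLatency
    (Finset.card {l | (y l).succ = a ∨ ∃ l', l' ≠ l ∧ y l' = y l} + 1)

/-- No action beats transmitting, against at most four uniformly transmitting opponents. -/
theorem scaledLatency_le : ∀ d < 5, ∀ a : Action 3,
    scaledLatency (d + 1) * 3 ^ d ≤ 400 * 3 ^ d + ∑ y : Fin d → Fin 3, scaledCost a y := by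
  decide +kernel

/-- First-step equation: every channel gives the value `scaledLatency`. -/
theorem scaledLatency_eq : ∀ d < 5, ∀ a : Action 3, a ≠ 0 →
    scaledLatency (d + 1) * 3 ^ d = 400 * 3 ^ d + ∑ y : Fin d → Fin 3, scaledCost a y := by
  decide +kernel

theorem meanLatency_le_three (m : ℕ) : meanLatency m ≤ 3 := by
  have h : scaledLatency m ≤ 3 * 400 := by unfold scaledLatency; split <;> omega
  refine ENNReal.div_le_of_le_mul ?_
  exact_mod_cast h

theorem meanLatency_eq_div (d : ℕ) :
    meanLatency (d + 1) = ((scaledLatency (d + 1) * 3 ^ d : ℕ) : ℝ≥0∞) / (400 * 3 ^ d) := by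
  push_cast
  rw [meanLatency, ENNReal.mul_div_mul_right _ _ (by simp) (by finiteness)]

theorem one_add_div_eq (d N : ℕ) :
    1 + (N : ℝ≥0∞) / (400 * 3 ^ d) = ((400 * 3 ^ d + N : ℕ) : ℝ≥0∞) / (400 * 3 ^ d) := by
  push_cast
  rw [ENNReal.add_div, ENNReal.div_self (by simp) (by finiteness)]

/-! ### Reduction of a slot to the actions of the pending players -/

/-- The transmission vector in which player `i` plays `a`, the other players of `S` transmit on the
channels `y` (through the enumeration `σ`), and the players outside `S` do nothing. -/
def slotVec {n d : ℕ} {S : Finset (Fin n)} {i : Fin n} (σ : ↥(S.erase i) ≃ Fin d)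
    (a : Action 3) (y : Fin d → Fin 3) : TransVec n 3 :=
  fun j => if h : j ∈ S.erase i then (y (σ ⟨j, h⟩)).succ else if j = i then a else 0

section slotVec

variable {n d : ℕ} {S : Finset (Fin n)} {i : Fin n} (σ : ↥(S.erase i) ≃ Fin d)

@[simp]
theorem slotVec_self (a : Action 3) (y : Fin d → Fin 3) : slotVec σ a y i = a := by
  simp [slotVec]

@[simp]
theorem slotVec_coe (a : Action 3) (y : Fin d → Fin 3) (j : ↥(S.erase i)) :
    slotVec σ a y j = (y (σ j)).succ := by
  unfold slotVec
  rw [dif_pos j.2]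

theorem slotVec_of_notMem (hi : i ∈ S) (a : Action 3) (y : Fin d → Fin 3) {j : Fin n}
    (hj : j ∉ S) : slotVec σ a y j = 0 := by
  have hne : j ≠ i := fun h => hj (h ▸ hi)
  simp [slotVec, hj, hne]

theorem slotVec_injective :
    Function.Injective fun p : Action 3 × (Fin d → Fin 3) => slotVec σ p.1 p.2 := by
  rintro ⟨a, y⟩ ⟨a', y'⟩ h
  have ha : a = a' := by simpa using congrFun h i
  have hy : y = y' := by
    funext l
    simpa using congrFun h (σ.symm l)
  rw [ha, hy]

/-- A case distinction over the players: `i`, the others in `S`, and those outside `S`. -/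
theorem forall_player_iff (P : Fin n → Prop) :
    (∀ j, P j) ↔ P i ∧ (∀ l, P (σ.symm l)) ∧ ∀ j, j ∉ S → P j := by
  refine ⟨fun h => ⟨h _, fun _ => h _, fun j _ => h j⟩, fun ⟨h₁, h₂, h₃⟩ j => ?_⟩
  by_cases hj : j ∈ S
  · by_cases hji : j = i
    · exact hji ▸ h₁
    · simpa using h₂ (σ ⟨j, Finset.mem_erase.2 ⟨hji, hj⟩⟩)
  · exact h₃ j hj

theorem succeeds_slotVec_self (hi : i ∈ S) (a : Action 3) (y : Fin d → Fin 3) :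
    Succeeds (slotVec σ a y) i ↔ a ≠ 0 ∧ ∀ l, (y l).succ ≠ a := by
  unfold Succeeds
  rw [forall_player_iff σ]
  simp only [slotVec_self, ne_eq, not_true_eq_false, IsEmpty.forall_iff, true_and, slotVec_coe,
    Equiv.apply_symm_apply]
  refine and_congr_right fun ha => ⟨fun h l => h.1 l ?_, fun h => ⟨fun l _ => h l, ?_⟩⟩
  · exact Finset.ne_of_mem_erase (σ.symm l).2
  · intro j hj _
    rw [slotVec_of_notMem σ hi a y hj]
    exact Ne.symm ha

theorem succeeds_slotVec_symm (hi : i ∈ S) (a : Action 3) (y : Fin d → Fin 3) (l : Fin d) :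
    Succeeds (slotVec σ a y) (σ.symm l) ↔
      ¬((y l).succ = a ∨ ∃ l', l' ≠ l ∧ y l' = y l) := by
  unfold Succeeds
  rw [forall_player_iff σ]
  simp only [slotVec_coe, Equiv.apply_symm_apply, slotVec_self, ne_eq, Fin.succ_ne_zero,
    not_false_eq_true, true_and, not_or, not_exists, not_and, Fin.succ_inj]
  have hli : i ≠ (σ.symm l : Fin n) := (Finset.ne_of_mem_erase (σ.symm l).2).symm
  constructor
  · rintro ⟨h₁, h₂, -⟩
    refine ⟨fun h => h₁ hli h.symm, fun l' hl' => h₂ l' fun h => hl' ?_⟩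
    simpa using h
  · rintro ⟨h₁, h₂⟩
    refine ⟨fun _ h => h₁ h.symm, fun l' hl' => h₂ l' fun h => hl' (by rw [h]), ?_⟩
    intro j hj _
    rw [slotVec_of_notMem σ hi a y hj]
    exact (Fin.succ_ne_zero _).symm

open Classical in
theorem card_filter_not_succeeds_slotVec (hi : i ∈ S) (a : Action 3) (y : Fin d → Fin 3)
    (hs : ¬ Succeeds (slotVec σ a y) i) :
    (S.filter fun j => ¬ Succeeds (slotVec σ a y) j).card =
      Finset.card {l | (y l).succ = a ∨ ∃ l', l' ≠ l ∧ y l' = y l} + 1 := by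
  have hS : S.filter (fun j => ¬ Succeeds (slotVec σ a y) j) =
      insert i ((S.erase i).filter fun j => ¬ Succeeds (slotVec σ a y) j) := by
    ext j
    by_cases hj : j = i <;> simp [hj, hi, hs]
  rw [hS, Finset.card_insert_of_notMem (by simp)]
  congr 1
  refine Finset.card_bij' (fun j hj => σ ⟨j, (Finset.mem_filter.1 hj).1⟩)
    (fun l _ => (σ.symm l : Fin n)) ?_ ?_ ?_ ?_
  · intro j hj
    have h := (Finset.mem_filter.1 hj).2
    rw [show j = σ.symm (σ ⟨j, (Finset.mem_filter.1 hj).1⟩) by simp,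
      succeeds_slotVec_symm σ hi, not_not] at h
    simpa using h
  · intro l hl
    refine Finset.mem_filter.2 ⟨(σ.symm l).2, ?_⟩
    rw [succeeds_slotVec_symm σ hi, not_not]
    simpa using hl
  · intro j hj
    simp
  · intro l hl
    simp

end slotVec

/-! ### The potential in one slot -/

open Classical in
/-- The expected number of further slots of player `i` after a slot with transmission vector `x`,
where `S` is the set of pending players before this slot. -/
noncomputable def nextLatency {n : ℕ} (S : Finset (Fin n)) (i : Fin n) (x : TransVec n 3) :
    ℝ≥0∞ :=
  if Succeeds x i then 0 else meanLatency (S.filter fun j => ¬ Succeeds x j).card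

theorem nextLatency_slotVec {n d : ℕ} {S : Finset (Fin n)} {i : Fin n}
    (σ : ↥(S.erase i) ≃ Fin d) (hi : i ∈ S) (a : Action 3) (y : Fin d → Fin 3) :
    nextLatency S i (slotVec σ a y) = (scaledCost a y : ℝ≥0∞) / 400 := by
  unfold nextLatency scaledCost
  by_cases h : Succeeds (slotVec σ a y) i
  · rw [if_pos h, if_pos ((succeeds_slotVec_self σ hi a y).1 h)]
    simp
  · rw [if_neg h, if_neg fun h' => h ((succeeds_slotVec_self σ hi a y).2 h'),
      card_filter_not_succeeds_slotVec σ hi a y h, meanLatency]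

theorem uniformProtocol_apply_zero (t : ℕ) (b : PersonalHistory 3 t) :
    uniformProtocol 3 t b 0 = 0 := by
  simp [uniformProtocol]

theorem uniformProtocol_apply_of_ne_zero (t : ℕ) (b : PersonalHistory 3 t) {a : Action 3}
    (ha : a ≠ 0) : uniformProtocol 3 t b a = 3⁻¹ := by
  simp [uniformProtocol, ha]

/-- The integral of `nextLatency` over a slot in which player `i` draws from `q i`, the other
players of `S` draw uniformly from the channels and the rest does nothing. -/
theorem lintegral_nextLatency {n d : ℕ} {S : Finset (Fin n)} {i : Fin n}
    (σ : ↥(S.erase i) ≃ Fin d) (hi : i ∈ S) (q : Fin n → PMF (Action 3))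
    (hq : ∀ j ∈ S.erase i, q j 0 = 0 ∧ ∀ c ≠ 0, q j c = 3⁻¹) (hq' : ∀ j ∉ S, q j = PMF.pure 0) :
    ∫⁻ x, nextLatency S i x ∂(Measure.pi fun j => (q j).toMeasure) =
      ∑ a, q i a * (((∑ y : Fin d → Fin 3, scaledCost a y : ℕ) : ℝ≥0∞) / (400 * 3 ^ d)) := by
  have hprod (a : Action 3) (y : Fin d → Fin 3) :
      ∏ j, q j (slotVec σ a y j) = q i a * 3⁻¹ ^ d := by
    have h₁ : ∏ j, q j (slotVec σ a y j) = ∏ j ∈ S, q j (slotVec σ a y j) := by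
      refine (Finset.prod_subset (Finset.subset_univ S) fun j _ hj => ?_).symm
      rw [slotVec_of_notMem σ hi a y hj, hq' j hj]
      simp
    rw [h₁, ← Finset.mul_prod_erase _ _ hi, slotVec_self]
    congr 1
    have hcard : (S.erase i).card = d := by
      rw [← Fintype.card_coe, Fintype.card_congr σ, Fintype.card_fin]
    rw [Finset.prod_congr rfl (g := fun _ => (3 : ℝ≥0∞)⁻¹), Finset.prod_const, hcard]
    intro j hj
    refine (hq j hj).2 _ ?_
    rw [slotVec_coe σ a y ⟨j, hj⟩]
    exact Fin.succ_ne_zero _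
  -- Vectors that are not of the form `slotVec σ a y` have probability zero.
  have hzero (x : TransVec n 3)
      (hx : x ∉ Set.range fun p : Action 3 × (Fin d → Fin 3) => slotVec σ p.1 p.2) :
      nextLatency S i x * ∏ j, q j (x j) = 0 := by
    rw [mul_eq_zero, Finset.prod_eq_zero_iff]
    right
    by_contra! hne
    have hne' : ∀ j ∈ S.erase i, x j ≠ 0 := fun j hj h0 => hne j (Finset.mem_univ j) (by
      rw [h0, (hq j hj).1])
    refine hx ⟨(x i, fun l => (x (σ.symm l)).pred (hne' _ (σ.symm l).2)), ?_⟩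
    refine funext ((forall_player_iff σ _).2 ⟨by simp, fun l => by simp, fun j hj => ?_⟩)
    have := hne j (Finset.mem_univ j)
    rw [hq' j hj] at this
    refine (slotVec_of_notMem σ hi _ _ hj).trans ?_
    by_contra h0
    exact this (by simp [Ne.symm h0])
  rw [lintegral_fintype]
  simp_rw [Measure.pi_singleton, PMF.toMeasure_apply_singleton _ _ (MeasurableSet.singleton _)]
  rw [← Fintype.sum_of_injective _ (slotVec_injective σ)
    (fun p => nextLatency S i (slotVec σ p.1 p.2) * ∏ j, q j (slotVec σ p.1 p.2 j)) _ hzero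
    fun _ => rfl, Fintype.sum_prod_type]
  refine Finset.sum_congr rfl fun a _ => ?_
  rw [Nat.cast_sum, div_eq_mul_inv, Finset.sum_mul, Finset.mul_sum]
  refine Finset.sum_congr rfl fun y _ => ?_
  rw [hprod, nextLatency_slotVec σ hi, div_eq_mul_inv,
    ENNReal.mul_inv (by simp) (by simp), ENNReal.inv_pow]
  ring

open Classical in
/-- The players that are pending after the history `h`. -/
noncomputable def pendingSet {n k t : ℕ} (h : History n k t) : Finset (Fin n) := {j | Pending h j}

section oneSlot

variable {n : ℕ} {F : Fin n → Protocol 3} {i : Fin n}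

theorem lintegral_nextLatency_stepLaw (hF : ∀ j ≠ i, F j = uniformProtocol 3) {t d : ℕ}
    (h : History n 3 t) (hi : Pending h i) (hd : (pendingSet h).card = d + 1) :
    ∫⁻ x, nextLatency (pendingSet h) i x ∂(stepLaw F h) =
      ∑ a, F i t (personal h i) a *
        (((∑ y : Fin d → Fin 3, scaledCost a y : ℕ) : ℝ≥0∞) / (400 * 3 ^ d)) := by
  classical
  have hmem : i ∈ pendingSet h := by simpa [pendingSet] using hi
  have hcard : ((pendingSet h).erase i).card = d := by rw [Finset.card_erase_of_mem hmem, hd]; rfl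
  have key := lintegral_nextLatency (Finset.equivFinOfCardEq hcard) hmem
    (fun j => if Pending h j then F j t (personal h j) else PMF.pure 0) ?_ ?_
  · simp only [if_pos hi] at key
    rw [← key, stepLaw]
  · intro j hj
    obtain ⟨hji, hj⟩ := Finset.mem_erase.1 hj
    have hj' : Pending h j := by simpa [pendingSet] using hj
    simp only [if_pos hj', hF j hji]
    exact ⟨uniformProtocol_apply_zero _ _, fun c hc => uniformProtocol_apply_of_ne_zero _ _ hc⟩
  · intro j hj
    have hj' : ¬ Pending h j := by simpa [pendingSet] using hj
    simp only [if_neg hj']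

theorem sum_pmf_mul_const (p : PMF (Action 3)) (c : ℝ≥0∞) : ∑ a, p a * c = c := by
  rw [← Finset.sum_mul, ← tsum_fintype (L := .unconditional _), p.tsum_coe, one_mul]

theorem exists_card_pendingSet (hn : n ≤ 5) {t : ℕ} {h : History n 3 t} (hi : Pending h i) :
    ∃ d < 5, (pendingSet h).card = d + 1 := by
  classical
  have hpos : 0 < (pendingSet h).card := Finset.card_pos.2 ⟨i, by simpa [pendingSet] using hi⟩
  have hle : (pendingSet h).card ≤ n := by simpa using Finset.card_le_univ (pendingSet h)
  exact ⟨(pendingSet h).card - 1, by omega, by omega⟩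

/-- Against uniform opponents no decision rule of player `i` decreases the potential in one slot. -/
theorem meanLatency_le_stepLaw (hn : n ≤ 5) (hF : ∀ j ≠ i, F j = uniformProtocol 3) {t : ℕ}
    (h : History n 3 t) (hi : Pending h i) :
    meanLatency (pendingSet h).card ≤
      1 + ∫⁻ x, nextLatency (pendingSet h) i x ∂(stepLaw F h) := by
  obtain ⟨d, hd5, hd⟩ := exists_card_pendingSet hn hi
  rw [lintegral_nextLatency_stepLaw hF h hi hd, hd,
    ← sum_pmf_mul_const (F i t (personal h i)) (meanLatency (d + 1)),
    ← sum_pmf_mul_const (F i t (personal h i)) 1, ← Finset.sum_add_distrib]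
  refine Finset.sum_le_sum fun a _ => ?_
  rw [← mul_add, one_add_div_eq, meanLatency_eq_div]
  gcongr
  exact scaledLatency_le d hd5 a

/-- The potential is preserved in a slot in which player `i` transmits uniformly as well. -/
theorem stepLaw_eq_meanLatency (hn : n ≤ 5) (hF : ∀ j ≠ i, F j = uniformProtocol 3) {t : ℕ}
    (hFi : F i t = uniformProtocol 3 t) (h : History n 3 t) (hi : Pending h i) :
    1 + ∫⁻ x, nextLatency (pendingSet h) i x ∂(stepLaw F h) =
      meanLatency (pendingSet h).card := by
  obtain ⟨d, hd5, hd⟩ := exists_card_pendingSet hn hi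
  rw [lintegral_nextLatency_stepLaw hF h hi hd, hd,
    ← sum_pmf_mul_const (F i t (personal h i)) (meanLatency (d + 1)),
    ← sum_pmf_mul_const (F i t (personal h i)) 1, ← Finset.sum_add_distrib]
  refine Finset.sum_congr rfl fun a _ => ?_
  rw [← mul_add, one_add_div_eq, meanLatency_eq_div]
  obtain rfl | ha := eq_or_ne a 0
  · simp [hFi, uniformProtocol_apply_zero]
  · rw [scaledLatency_eq d hd5 a ha]

end oneSlot

end Contention

/-! ### Integrals along trajectories of kernels -/

namespace ProbabilityTheory.Kernel

open Preorder

variable {X : ℕ → Type*} [∀ m, MeasurableSpace (X m)]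
  {κ κ' : (m : ℕ) → Kernel (Π s : Finset.Iic m, X s) (X (m + 1))}

theorem partialTraj_congr {a b : ℕ} (hab : a ≤ b) (h : ∀ m, a ≤ m → m < b → κ m = κ' m) :
    partialTraj κ a b = partialTraj κ' a b := by
  induction b, hab using Nat.le_induction with
  | base => simp
  | succ b hab ih =>
    rw [partialTraj_succ_of_le hab, partialTraj_succ_of_le hab, h b hab (Nat.lt_succ_self b),
      ih fun m hm hmb => h m hm (hmb.trans (Nat.lt_succ_self b))]

variable [∀ m, IsMarkovKernel (κ m)]

/-- The coordinates `0, …, b` of a trajectory have the law `partialTraj κ a b`. -/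
theorem setLIntegral_traj_frestrictLe {a b : ℕ} (x₀ : Π s : Finset.Iic a, X s)
    {A : Set (Π s : Finset.Iic b, X s)} (hA : MeasurableSet A)
    {G : (Π s : Finset.Iic b, X s) → ℝ≥0∞} (hG : Measurable G) :
    ∫⁻ x in frestrictLe b ⁻¹' A, G (frestrictLe b x) ∂(traj κ a x₀) =
      ∫⁻ y in A, G y ∂(partialTraj κ a b x₀) := by
  rw [← traj_map_frestrictLe_apply, setLIntegral_map hA hG (by fun_prop)]

/-- The coordinate `b + 1` of a trajectory has, given the previous ones, the law `κ b`. -/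
theorem setLIntegral_traj_succ {a b : ℕ} (hab : a ≤ b) (x₀ : Π s : Finset.Iic a, X s)
    {A : Set (Π s : Finset.Iic b, X s)} (hA : MeasurableSet A)
    {G : (Π s : Finset.Iic b, X s) → X (b + 1) → ℝ≥0∞} (hG : Measurable G.uncurry) :
    ∫⁻ x in frestrictLe b ⁻¹' A, G (frestrictLe b x) (x (b + 1)) ∂(traj κ a x₀) =
      ∫⁻ y in A, ∫⁻ z, G y z ∂(κ b y) ∂(partialTraj κ a b x₀) := by
  have h := Measure.setLIntegral_compProd (μ := partialTraj κ a b x₀) (κ := κ b) hG hA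
    MeasurableSet.univ
  rw [partialTraj_compProd_eq_map_traj hab,
    setLIntegral_map (hA.prod MeasurableSet.univ) hG (by fun_prop)] at h
  simp only [Measure.restrict_univ] at h
  have hset : (fun x : Π m, X m => (frestrictLe b x, x (b + 1))) ⁻¹' A ×ˢ Set.univ =
      frestrictLe b ⁻¹' A := by
    ext x
    simp
  rw [hset] at h
  exact h

end ProbabilityTheory.Kernel

/-! ### Latency and pending players along a transmission sequence -/

namespace Contention

open Preorder

variable {n k : ℕ} {i : Fin n}

theorem pending_ofSeq_frestrictLe {t : ℕ} {x : ℕ → TransVec n k} :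
    Pending (ofSeq (frestrictLe (π := fun _ => TransVec n k) t x)) i ↔
      ∀ s < t, ¬ Succeeds (x (s + 1)) i :=
  ⟨fun h s hs => h ⟨s, hs⟩, fun h s => h s s.isLt⟩

theorem pending_succ_iff {t : ℕ} {x : ℕ → TransVec n k} (j : Fin n) :
    Pending (ofSeq (frestrictLe (π := fun _ => TransVec n k) (t + 1) x)) j ↔
      Pending (ofSeq (frestrictLe (π := fun _ => TransVec n k) t x)) j ∧
        ¬ Succeeds (x (t + 1)) j := by
  simp only [pending_ofSeq_frestrictLe, Nat.forall_lt_succ_right]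

theorem measurable_latency : Measurable (latency (k := k) i) := by
  unfold latency
  refine Measurable.iInf fun t => ?_
  have hm : MeasurableSet {x : ℕ → TransVec n k | 1 ≤ t ∧ Succeeds (x t) i} :=
    measurable_pi_apply (X := fun _ => TransVec n k) t
      (MeasurableSet.of_discrete (s := {z | 1 ≤ t ∧ Succeeds z i}))
  classical
  have : (fun x : ℕ → TransVec n k => ⨅ (_ : 1 ≤ t ∧ Succeeds (x t) i), (t : ℝ≥0∞)) =
      fun x => if 1 ≤ t ∧ Succeeds (x t) i then (t : ℝ≥0∞) else ∞ := by
    funext x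
    rw [iInf_eq_if]
  rw [this]
  exact Measurable.ite hm measurable_const measurable_const

theorem latency_le {t : ℕ} {x : ℕ → TransVec n k} (h : Succeeds (x (t + 1)) i) :
    latency i x ≤ (t : ℝ≥0∞) + 1 := by
  refine (iInf₂_le (t + 1) ⟨by omega, h⟩).trans_eq ?_
  push_cast
  rfl

theorem add_one_le_latency {t : ℕ} {x : ℕ → TransVec n k}
    (h : Pending (ofSeq (frestrictLe (π := fun _ => TransVec n k) t x)) i) :
    (t : ℝ≥0∞) + 1 ≤ latency i x := by
  rw [pending_ofSeq_frestrictLe] at h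
  refine le_iInf₂ fun s hs => ?_
  have : t + 1 ≤ s := by
    by_contra hlt
    refine h (s - 1) (by omega) ?_
    rw [Nat.sub_add_cancel hs.1]
    exact hs.2
  exact_mod_cast this

theorem lt_latency_iff {t : ℕ} {x : ℕ → TransVec n k} :
    (t : ℝ≥0∞) < latency i x ↔
      Pending (ofSeq (frestrictLe (π := fun _ => TransVec n k) t x)) i := by
  refine ⟨fun h => pending_ofSeq_frestrictLe.2 fun s hs hsucc => ?_, fun h => ?_⟩
  · refine absurd (h.trans_le (latency_le hsucc)) (not_lt.2 ?_)
    exact_mod_cast Nat.succ_le_of_lt hs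
  · refine lt_of_lt_of_le ?_ (add_one_le_latency h)
    exact_mod_cast Nat.lt_succ_self t

theorem stepKernel_congr {F F' : Fin n → Protocol k} {t : ℕ} (h : ∀ j, F j t = F' j t) :
    stepKernel F t = stepKernel F' t := by
  refine Kernel.ext fun x => ?_
  simp only [stepKernel, Kernel.coe_mk, stepLaw, h]

/-! ### The potential as a submartingale -/

open Classical in
/-- The conditional expectation of the latency of player `i` after slot `t` when everybody plays
`uniformProtocol 3` from then on: her latency, if she has left by then, and otherwise `t` plus the
mean latency for the current number of pending players. -/
noncomputable def potential (i : Fin n) (t : ℕ) (x : ℕ → TransVec n 3) : ℝ≥0∞ :=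
  if Pending (ofSeq (frestrictLe (π := fun _ => TransVec n 3) t x)) i then
    t + meanLatency (pendingSet (ofSeq (frestrictLe (π := fun _ => TransVec n 3) t x))).card
  else latency i x

theorem potential_of_pending {t : ℕ} {x : ℕ → TransVec n 3}
    (h : Pending (ofSeq (frestrictLe (π := fun _ => TransVec n 3) t x)) i) :
    potential i t x =
      t + meanLatency (pendingSet (ofSeq (frestrictLe (π := fun _ => TransVec n 3) t x))).card :=
  if_pos h

theorem potential_of_not_pending {t : ℕ} {x : ℕ → TransVec n 3}
    (h : ¬ Pending (ofSeq (frestrictLe (π := fun _ => TransVec n 3) t x)) i) :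
    potential i t x = latency i x :=
  if_neg h

theorem potential_succ_of_pending {t : ℕ} {x : ℕ → TransVec n 3}
    (h : Pending (ofSeq (frestrictLe (π := fun _ => TransVec n 3) t x)) i) :
    potential i (t + 1) x =
      t + (1 + nextLatency (pendingSet (ofSeq (frestrictLe (π := fun _ => TransVec n 3) t x))) i
        (x (t + 1))) := by
  classical
  by_cases hs : Succeeds (x (t + 1)) i
  · rw [potential_of_not_pending fun h' => ((pending_succ_iff i).1 h').2 hs, nextLatency,
      if_pos hs, add_zero]
    exact le_antisymm (latency_le hs) (add_one_le_latency h)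
  · rw [potential_of_pending ((pending_succ_iff i).2 ⟨h, hs⟩), nextLatency, if_neg hs,
      ← add_assoc]
    push_cast
    congr 3
    ext j
    simp only [pendingSet, Finset.mem_filter, Finset.mem_univ, true_and, pending_succ_iff]

theorem min_latency_le_potential (t : ℕ) (x : ℕ → TransVec n 3) :
    min (latency i x) t ≤ potential i t x := by
  by_cases h : Pending (ofSeq (frestrictLe (π := fun _ => TransVec n 3) t x)) i
  · rw [potential_of_pending h]
    exact (min_le_right _ _).trans le_self_add
  · rw [potential_of_not_pending h]
    exact min_le_left _ _

theorem potential_le_latency_add (t : ℕ) (x : ℕ → TransVec n 3) :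
    potential i t x ≤ latency i x + {x | (t : ℝ≥0∞) ≤ latency i x}.indicator (fun _ => 3) x := by
  by_cases h : Pending (ofSeq (frestrictLe (π := fun _ => TransVec n 3) t x)) i
  · have hle : (t : ℝ≥0∞) ≤ latency i x := (lt_latency_iff.2 h).le
    rw [potential_of_pending h, Set.indicator_of_mem (by exact hle)]
    exact add_le_add hle (meanLatency_le_three _)
  · rw [potential_of_not_pending h]
    exact le_self_add

section law

variable {F : Fin n → Protocol 3} {a t : ℕ} (x₀ : Finset.Iic a → TransVec n 3)

theorem setLIntegral_potential (A : Set (Finset.Iic t → TransVec n 3))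
    (hA : ∀ y ∈ A, Pending (ofSeq y) i) :
    ∫⁻ x in frestrictLe t ⁻¹' A, potential i t x
        ∂(Kernel.traj (X := fun _ => TransVec n 3) (stepKernel F) a x₀) =
      ∫⁻ y in A, t + meanLatency (pendingSet (ofSeq y)).card
        ∂(Kernel.partialTraj (X := fun _ => TransVec n 3) (stepKernel F) a t x₀) := by
  have hAm : MeasurableSet A := .of_discrete
  rw [← Kernel.setLIntegral_traj_frestrictLe (X := fun _ => TransVec n 3) (κ := stepKernel F) x₀
    hAm .of_discrete]
  refine setLIntegral_congr_fun (by measurability) fun x hx => ?_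
  exact potential_of_pending (hA _ hx)

theorem setLIntegral_potential_succ (hat : a ≤ t) (A : Set (Finset.Iic t → TransVec n 3))
    (hA : ∀ y ∈ A, Pending (ofSeq y) i) :
    ∫⁻ x in frestrictLe t ⁻¹' A, potential i (t + 1) x
        ∂(Kernel.traj (X := fun _ => TransVec n 3) (stepKernel F) a x₀) =
      ∫⁻ y in A, t + (1 + ∫⁻ z, nextLatency (pendingSet (ofSeq y)) i z ∂(stepLaw F (ofSeq y)))
        ∂(Kernel.partialTraj (X := fun _ => TransVec n 3) (stepKernel F) a t x₀) := by
  have hAm : MeasurableSet A := .of_discrete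
  have h := Kernel.setLIntegral_traj_succ (X := fun _ => TransVec n 3) (κ := stepKernel F) hat x₀
    hAm (G := fun y z => t + (1 + nextLatency (pendingSet (ofSeq y)) i z)) .of_discrete
  have hstep (y : Finset.Iic t → TransVec n 3) :
      ∫⁻ z, t + (1 + nextLatency (pendingSet (ofSeq y)) i z) ∂(stepKernel F t y) =
        t + (1 + ∫⁻ z, nextLatency (pendingSet (ofSeq y)) i z ∂(stepLaw F (ofSeq y))) := by
    rw [lintegral_add_left measurable_const, lintegral_add_left measurable_const]
    simp [stepKernel]
  simp_rw [hstep] at h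
  rw [← h]
  refine setLIntegral_congr_fun (by measurability) fun x hx => ?_
  exact potential_succ_of_pending (hA _ hx)

theorem setLIntegral_potential_split (m : ℕ) (μ : Measure (ℕ → TransVec n 3))
    (A : Set (Finset.Iic t → TransVec n 3)) :
    ∫⁻ x in frestrictLe t ⁻¹' A, potential i m x ∂μ =
      ∫⁻ x in frestrictLe t ⁻¹' (A ∩ {y | Pending (ofSeq y) i}), potential i m x ∂μ +
      ∫⁻ x in frestrictLe t ⁻¹' (A \ {y | Pending (ofSeq y) i}), potential i m x ∂μ := by
  have hP : MeasurableSet (frestrictLe (π := fun _ => TransVec n 3) t ⁻¹'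
      {y | Pending (ofSeq y) i}) :=
    measurable_frestrictLe t .of_discrete
  rw [Set.preimage_inter, Set.preimage_sdiff, lintegral_inter_add_sdiff _ _ hP]

/-- The potential no longer changes once player `i` has left. -/
theorem setLIntegral_potential_of_left (μ : Measure (ℕ → TransVec n 3))
    (A : Set (Finset.Iic t → TransVec n 3)) :
    ∫⁻ x in frestrictLe t ⁻¹' (A \ {y | Pending (ofSeq y) i}), potential i (t + 1) x ∂μ =
      ∫⁻ x in frestrictLe t ⁻¹' (A \ {y | Pending (ofSeq y) i}), potential i t x ∂μ := by
  refine setLIntegral_congr_fun (measurable_frestrictLe t .of_discrete) fun x hx => ?_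
  have hx' : ¬ Pending (ofSeq (frestrictLe (π := fun _ => TransVec n 3) t x)) i := hx.2
  rw [potential_of_not_pending hx',
    potential_of_not_pending fun h => hx' ((pending_succ_iff i).1 h).1]

/-- Against uniform opponents the potential is a submartingale. -/
theorem setLIntegral_potential_le_succ (hn : n ≤ 5) (hF : ∀ j ≠ i, F j = uniformProtocol 3)
    (hat : a ≤ t) (A : Set (Finset.Iic t → TransVec n 3)) :
    ∫⁻ x in frestrictLe t ⁻¹' A, potential i t x
        ∂(Kernel.traj (X := fun _ => TransVec n 3) (stepKernel F) a x₀) ≤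
      ∫⁻ x in frestrictLe t ⁻¹' A, potential i (t + 1) x
        ∂(Kernel.traj (X := fun _ => TransVec n 3) (stepKernel F) a x₀) := by
  rw [setLIntegral_potential_split, setLIntegral_potential_split (t + 1),
    setLIntegral_potential_of_left,
    setLIntegral_potential _ (A ∩ {y | Pending (ofSeq y) i}) fun y hy => hy.2,
    setLIntegral_potential_succ _ hat (A ∩ {y | Pending (ofSeq y) i}) fun y hy => hy.2]
  gcongr ?_ + _
  refine setLIntegral_mono .of_discrete fun y hy => ?_
  gcongr
  exact meanLatency_le_stepLaw hn hF _ hy.2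

/-- If player `i` transmits uniformly as well, the potential is a martingale. -/
theorem setLIntegral_potential_succ_eq (hn : n ≤ 5) (hF : ∀ j ≠ i, F j = uniformProtocol 3)
    (hFi : F i t = uniformProtocol 3 t) (hat : a ≤ t)
    (A : Set (Finset.Iic t → TransVec n 3)) :
    ∫⁻ x in frestrictLe t ⁻¹' A, potential i (t + 1) x
        ∂(Kernel.traj (X := fun _ => TransVec n 3) (stepKernel F) a x₀) =
      ∫⁻ x in frestrictLe t ⁻¹' A, potential i t x
        ∂(Kernel.traj (X := fun _ => TransVec n 3) (stepKernel F) a x₀) := by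
  rw [setLIntegral_potential_split, setLIntegral_potential_split t,
    setLIntegral_potential_of_left,
    setLIntegral_potential _ (A ∩ {y | Pending (ofSeq y) i}) fun y hy => hy.2,
    setLIntegral_potential_succ _ hat (A ∩ {y | Pending (ofSeq y) i}) fun y hy => hy.2]
  congr 1
  refine setLIntegral_congr_fun .of_discrete fun y hy => ?_
  simp only [stepLaw_eq_meanLatency hn hF hFi _ hy.2]

/-- An event determined by the first `t` slots is determined by the first `m ≥ t` slots. -/
theorem frestrictLe_preimage_eq {m : ℕ} (htm : t ≤ m) (A : Set (Finset.Iic t → TransVec n k)) :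
    frestrictLe (π := fun _ => TransVec n k) t ⁻¹' A =
      frestrictLe (π := fun _ => TransVec n k) m ⁻¹'
        (frestrictLe₂ (π := fun _ => TransVec n k) htm ⁻¹' A) := rfl

theorem setLIntegral_potential_mono (hn : n ≤ 5) (hF : ∀ j ≠ i, F j = uniformProtocol 3)
    (hat : a ≤ t) (A : Set (Finset.Iic t → TransVec n 3)) {m : ℕ} (htm : t ≤ m) :
    ∫⁻ x in frestrictLe t ⁻¹' A, potential i t x
        ∂(Kernel.traj (X := fun _ => TransVec n 3) (stepKernel F) a x₀) ≤
      ∫⁻ x in frestrictLe t ⁻¹' A, potential i m x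
        ∂(Kernel.traj (X := fun _ => TransVec n 3) (stepKernel F) a x₀) := by
  induction m, htm using Nat.le_induction with
  | base => exact le_rfl
  | succ m htm ih =>
    refine ih.trans ?_
    rw [frestrictLe_preimage_eq htm]
    exact setLIntegral_potential_le_succ x₀ hn hF (hat.trans htm) _

theorem setLIntegral_potential_eq (hn : n ≤ 5) (hF : ∀ j ≠ i, F j = uniformProtocol 3)
    (hFi : ∀ s, t ≤ s → F i s = uniformProtocol 3 s) (hat : a ≤ t)
    (A : Set (Finset.Iic t → TransVec n 3)) {m : ℕ} (htm : t ≤ m) :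
    ∫⁻ x in frestrictLe t ⁻¹' A, potential i m x
        ∂(Kernel.traj (X := fun _ => TransVec n 3) (stepKernel F) a x₀) =
      ∫⁻ x in frestrictLe t ⁻¹' A, potential i t x
        ∂(Kernel.traj (X := fun _ => TransVec n 3) (stepKernel F) a x₀) := by
  induction m, htm using Nat.le_induction with
  | base => rfl
  | succ m htm ih =>
    rw [← ih, frestrictLe_preimage_eq htm]
    exact setLIntegral_potential_succ_eq x₀ hn hF (hFi m htm) (hat.trans htm) _

/-- If the potential does not decrease on average, then it is a lower bound for the latency: when
the expected latency is finite, the event that it is at least `m`, on which the potential after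
slot `m` may exceed the latency by a constant, has vanishing probability. -/
theorem setLIntegral_potential_le_latency (hn : n ≤ 5) (hF : ∀ j ≠ i, F j = uniformProtocol 3)
    (hat : a ≤ t) (A : Set (Finset.Iic t → TransVec n 3)) :
    ∫⁻ x in frestrictLe t ⁻¹' A, potential i t x
        ∂(Kernel.traj (X := fun _ => TransVec n 3) (stepKernel F) a x₀) ≤
      ∫⁻ x in frestrictLe t ⁻¹' A, latency i x
        ∂(Kernel.traj (X := fun _ => TransVec n 3) (stepKernel F) a x₀) := by
  set μ := (Kernel.traj (X := fun _ => TransVec n 3) (stepKernel F) a x₀).restrict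
    (frestrictLe t ⁻¹' A)
  by_cases htop : ∫⁻ x, latency i x ∂μ = ∞
  · rw [htop]
    exact le_top
  have hbound (m : ℕ) (hm : t + 1 ≤ m) : ∫⁻ x, potential i t x ∂μ ≤
      ∫⁻ x, latency i x ∂μ + 3 * ((∫⁻ x, latency i x ∂μ) / m) := by
    have hm0 : (m : ℝ≥0∞) ≠ 0 := by exact_mod_cast (by omega : m ≠ 0)
    calc ∫⁻ x, potential i t x ∂μ
        ≤ ∫⁻ x, potential i m x ∂μ :=
          setLIntegral_potential_mono x₀ hn hF hat A (by omega)
      _ ≤ ∫⁻ x, latency i x + {x | (m : ℝ≥0∞) ≤ latency i x}.indicator (fun _ => 3) x ∂μ :=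
          lintegral_mono fun x => potential_le_latency_add m x
      _ = ∫⁻ x, latency i x ∂μ + 3 * μ {x | (m : ℝ≥0∞) ≤ latency i x} := by
          rw [lintegral_add_left measurable_latency,
            lintegral_indicator_const (measurableSet_le measurable_const measurable_latency)]
      _ ≤ _ := by
          gcongr
          exact meas_ge_le_lintegral_div measurable_latency.aemeasurable hm0 (by simp)
  have hlim : Filter.Tendsto
      (fun m : ℕ => ∫⁻ x, latency i x ∂μ + 3 * ((∫⁻ x, latency i x ∂μ) / m))
      Filter.atTop (nhds (∫⁻ x, latency i x ∂μ + 3 * 0)) := by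
    refine tendsto_const_nhds.add (ENNReal.Tendsto.const_mul ?_ (Or.inr (by simp)))
    simp_rw [div_eq_mul_inv]
    rw [← mul_zero (∫⁻ x, latency i x ∂μ)]
    exact ENNReal.Tendsto.const_mul ENNReal.tendsto_inv_nat_nhds_zero (Or.inr htop)
  rw [mul_zero, add_zero] at hlim
  exact ge_of_tendsto hlim (Filter.eventually_atTop.2 ⟨t + 1, hbound⟩)

/-- If the potential is constant on average, then it is an upper bound for the latency, by
monotone convergence of the truncated latencies. -/
theorem setLIntegral_latency_le_potential (hn : n ≤ 5) (hF : ∀ j ≠ i, F j = uniformProtocol 3)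
    (hFi : ∀ s, t ≤ s → F i s = uniformProtocol 3 s) (hat : a ≤ t)
    (A : Set (Finset.Iic t → TransVec n 3)) :
    ∫⁻ x in frestrictLe t ⁻¹' A, latency i x
        ∂(Kernel.traj (X := fun _ => TransVec n 3) (stepKernel F) a x₀) ≤
      ∫⁻ x in frestrictLe t ⁻¹' A, potential i t x
        ∂(Kernel.traj (X := fun _ => TransVec n 3) (stepKernel F) a x₀) := by
  have hsup (x : ℕ → TransVec n 3) :
      latency i x = ⨆ m : ℕ, min (latency i x) (m : ℝ≥0∞) := by
    rw [← inf_iSup_eq, ENNReal.iSup_natCast, inf_top_eq]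
  rw [lintegral_congr hsup]
  rw [lintegral_iSup (fun m => measurable_latency.min measurable_const) fun m m' hmm x =>
    min_le_min le_rfl (by exact_mod_cast hmm)]
  refine iSup_le fun m => ?_
  rw [← setLIntegral_potential_eq x₀ hn hF hFi hat A (Nat.le_add_right t m)]
  refine lintegral_mono fun x => le_trans (min_le_min le_rfl ?_) (min_latency_le_potential _ x)
  exact_mod_cast Nat.le_add_left m t

/-- Against uniform opponents, switching to `uniformProtocol 3` after slot `t` is optimal, on every
event that is determined by the first `t` slots and on which player `i` is pending after them. -/
theorem setLIntegral_latency_le {F' : Fin n → Protocol 3} (hn : n ≤ 5)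
    (hF : ∀ j ≠ i, F j = uniformProtocol 3) (hF' : ∀ j ≠ i, F' j = uniformProtocol 3)
    (hFi : ∀ s, t ≤ s → F i s = uniformProtocol 3 s) (hat : a ≤ t)
    (hFF : ∀ s, a ≤ s → s < t → F i s = F' i s) (A : Set (Finset.Iic t → TransVec n 3))
    (hA : ∀ y ∈ A, Pending (ofSeq y) i) :
    ∫⁻ x in frestrictLe t ⁻¹' A, latency i x
        ∂(Kernel.traj (X := fun _ => TransVec n 3) (stepKernel F) a x₀) ≤
      ∫⁻ x in frestrictLe t ⁻¹' A, latency i x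
        ∂(Kernel.traj (X := fun _ => TransVec n 3) (stepKernel F') a x₀) := by
  have hlaw : Kernel.partialTraj (X := fun _ => TransVec n 3) (stepKernel F) a t =
      Kernel.partialTraj (X := fun _ => TransVec n 3) (stepKernel F') a t := by
    refine Kernel.partialTraj_congr hat fun s has hst => stepKernel_congr fun j => ?_
    obtain rfl | hj := eq_or_ne j i
    · exact hFF s has hst
    · rw [hF j hj, hF' j hj]
  refine (setLIntegral_latency_le_potential x₀ hn hF hFi hat A).trans ?_
  refine le_trans (le_of_eq ?_) (setLIntegral_potential_le_latency x₀ hn hF' hat A)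
  rw [setLIntegral_potential x₀ A hA, setLIntegral_potential x₀ A hA, hlaw]

end law

/-! ### Expected latency and equilibria -/

theorem pendingSet_emptyHistory : pendingSet (emptyHistory n k) = Finset.univ := by
  ext j
  simp [pendingSet, Pending]

/-- The history that the game continues is the initial segment of almost every trajectory. -/
theorem ae_gameLaw_mem_preimage (F : Fin n → Protocol k) {t : ℕ} (h : History n k t) :
    ∀ᵐ x ∂(gameLaw F h), x ∈ frestrictLe (π := fun _ => TransVec n k) t ⁻¹' {toSeq h} := by
  have hm : MeasurableSet ({toSeq h}ᶜ : Set (Finset.Iic t → TransVec n k)) := .of_discrete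
  rw [ae_iff]
  change gameLaw F h (frestrictLe (π := fun _ => TransVec n k) t ⁻¹' {toSeq h}ᶜ) = 0
  rw [gameLaw, ← Measure.map_apply (measurable_frestrictLe t) hm,
    Kernel.traj_map_frestrictLe_apply, Kernel.partialTraj_self, Kernel.id_apply,
    Measure.dirac_apply' _ hm]
  simp

theorem expLatency_eq_setLIntegral (F : Fin n → Protocol k) (i : Fin n) {t : ℕ}
    (h : History n k t) :
    expLatency F i h =
      ∫⁻ x in frestrictLe (π := fun _ => TransVec n k) t ⁻¹' {toSeq h}, latency i x
        ∂(Kernel.traj (X := fun _ => TransVec n k) (stepKernel F) t (toSeq h)) := by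
  rw [expLatency, ← Measure.restrict_eq_self_of_ae_mem (ae_gameLaw_mem_preimage F h)]
  rfl

/-- The expected latency of the uniform profile is the potential at the start. -/
theorem expLatency_uniformProfile (hn : n ≤ 5) (i : Fin n) :
    expLatency (uniformProfile n 3) i (emptyHistory n 3) = meanLatency n := by
  have hA : ∀ y ∈ ({toSeq (emptyHistory n 3)} : Set (Finset.Iic 0 → TransVec n 3)),
      Pending (ofSeq y) i := fun y _ s => s.elim0
  rw [expLatency_eq_setLIntegral]
  refine (le_antisymm
    (setLIntegral_latency_le_potential _ hn (fun _ _ => rfl) (fun _ _ => rfl) le_rfl _)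
    (setLIntegral_potential_le_latency _ hn (fun _ _ => rfl) le_rfl _)).trans ?_
  rw [setLIntegral_potential _ _ hA, Kernel.partialTraj_self, Kernel.id_apply,
    Measure.restrict_singleton, lintegral_smul_measure, lintegral_dirac, ofSeq_toSeq,
    pendingSet_emptyHistory]
  simp

theorem isFullEquilibrium_uniformProfile (hn : n ≤ 5) :
    IsFullEquilibrium (uniformProfile n 3) := by
  intro i t h _ hi g
  rw [expLatency_eq_setLIntegral, expLatency_eq_setLIntegral]
  refine setLIntegral_latency_le _ hn (fun _ _ => rfl)
    (fun j hj => by rw [Function.update_of_ne hj]; rfl) (fun _ _ => rfl) le_rfl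
    (fun s hts hst => absurd hts (not_le.2 hst)) _ ?_
  rintro y rfl
  rwa [ofSeq_toSeq]

theorem playThen_of_lt {t : ℕ} (a : PersonalHistory k t) (g g' : Protocol k) {s : ℕ}
    (hs : s < t) : playThen a g s = playThen a g' s := by
  funext b
  simp [playThen, hs]

theorem playThen_of_le {t : ℕ} (a : PersonalHistory k t) (g : Protocol k) {s : ℕ}
    (hs : t ≤ s) : playThen a g s = g s := by
  funext b
  simp [playThen, not_lt.2 hs]

theorem personalEvent_eq_preimage {t : ℕ} (i : Fin n) (a : PersonalHistory k t) :
    personalEvent i a = frestrictLe (π := fun _ => TransVec n k) t ⁻¹'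
      {y | personal (ofSeq y) i = a ∧ Pending (ofSeq y) i} := by
  ext x
  simp only [personalEvent, lt_latency_iff, Set.mem_ofPred_eq, Set.mem_preimage, funext_iff]
  rfl

/-- What player `i` does after slot `t` has no influence on the probability of her having a given
personal history up to slot `t`. -/
theorem personalLaw_personalEvent_update (f : Fin n → Protocol k) (g : Protocol k) {t : ℕ}
    (a : PersonalHistory k t) :
    personalLaw (Function.update f i g) i a (personalEvent i a) =
      personalLaw f i a (personalEvent i a) := by
  have hm : MeasurableSet {y : Finset.Iic t → TransVec n k |
      personal (ofSeq y) i = a ∧ Pending (ofSeq y) i} := .of_discrete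
  simp only [personalLaw, gameLaw, personalEvent_eq_preimage]
  rw [← Measure.map_apply (measurable_frestrictLe t) hm,
    ← Measure.map_apply (measurable_frestrictLe t) hm, Kernel.traj_map_frestrictLe_apply,
    Kernel.traj_map_frestrictLe_apply]
  congr 2
  refine Kernel.partialTraj_congr (Nat.zero_le t) fun s _ hst => stepKernel_congr fun j => ?_
  rw [Function.update_idem]
  obtain rfl | hj := eq_or_ne j i
  · simp only [Function.update_self]
    exact playThen_of_lt a _ _ hst
  · rw [Function.update_of_ne hj, Function.update_of_ne hj]

theorem isEquilibrium_uniformProfile (hn : n ≤ 5) : IsEquilibrium (uniformProfile n 3) := by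
  intro i t a _ g
  rw [personalExpLatency, personalExpLatency, ProbabilityTheory.cond, ProbabilityTheory.cond,
    lintegral_smul_measure, lintegral_smul_measure, personalLaw_personalEvent_update]
  gcongr _ • ?_
  simp only [personalLaw, gameLaw, personalEvent_eq_preimage, Function.update_idem,
    Function.update_self]
  have hothers (p : Protocol 3) (j : Fin n) (hj : j ≠ i) :
      Function.update (uniformProfile n 3) i p j = uniformProtocol 3 := by
    rw [Function.update_of_ne hj]
    rfl
  refine setLIntegral_latency_le _ hn (hothers _) (hothers _) (fun s hs => ?_) (Nat.zero_le t)
    (fun s _ hst => ?_) _ fun y hy => hy.2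
  · rw [Function.update_self, playThen_of_le _ _ hs]
    rfl
  · rw [Function.update_self, Function.update_self, playThen_of_lt _ _ _ hst]

end Contention

theorem mainTheorem7 :
    (∀ n ∈ ({2, 3, 4, 5} : Set ℕ),
      Contention.IsEquilibrium (Contention.uniformProfile n 3) ∧
      Contention.IsFullEquilibrium (Contention.uniformProfile n 3)) ∧
    (∀ i, Contention.expLatency (Contention.uniformProfile 2 3) i
      (Contention.emptyHistory 2 3) = 3 / 2) ∧
    (∀ i, Contention.expLatency (Contention.uniformProfile 3 3) i
      (Contention.emptyHistory 3 3) = 15 / 8) ∧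
    (∀ i, Contention.expLatency (Contention.uniformProfile 4 3) i
      (Contention.emptyHistory 4 3) = 189 / 80) ∧
    (∀ i, Contention.expLatency (Contention.uniformProfile 5 3) i
      (Contention.emptyHistory 5 3) = 597 / 200) := by
  have hdiv (a b c d : ℕ) (hb : b ≠ 0) (hd : d ≠ 0) (h : a * d = c * b) :
      (a : ℝ≥0∞) / b = c / d := by
    rw [ENNReal.div_eq_div_iff (by exact_mod_cast hd) (by simp) (by exact_mod_cast hb) (by simp)]
    exact_mod_cast (by linarith : d * a = b * c)
  refine ⟨fun n hn => ?_, fun i => ?_, fun i => ?_, fun i => ?_, fun i => ?_⟩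
  · have hn5 : n ≤ 5 := by
      simp only [Set.mem_insert_iff, Set.mem_singleton_iff] at hn
      omega
    exact ⟨Contention.isEquilibrium_uniformProfile hn5,
      Contention.isFullEquilibrium_uniformProfile hn5⟩
  · rw [Contention.expLatency_uniformProfile (by norm_num)]
    exact_mod_cast hdiv 600 400 3 2 (by norm_num) (by norm_num) (by norm_num)
  · rw [Contention.expLatency_uniformProfile (by norm_num)]
    exact_mod_cast hdiv 750 400 15 8 (by norm_num) (by norm_num) (by norm_num)
  · rw [Contention.expLatency_uniformProfile (by norm_num)]
    exact_mod_cast hdiv 945 400 189 80 (by norm_num) (by norm_num) (by norm_num)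
  · rw [Contention.expLatency_uniformProfile (by norm_num)]
    exact_mod_cast hdiv 1194 400 597 200 (by norm_num) (by norm_num) (by norm_num)
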